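/- Let $K$ be a field, $n\ge 0$, and $S=K[X_i,Y_i\mid 1\le i\le n]$. For $i,j\in[n]=\{1,\dots,n\}$ put $[i,j]=X_iY_j-Y_iX_j$. For a simple graph $G$ whose vertex set $V(G)$ is contained in $[n]$, let $I_G=([i,j]\mid \{i,j\}\text{ is an edge of }G)\subseteq S$, and for $A\subseteq[n]$ let $I_2(A)=([a,b]\mid a,b\in A)\subseteq S$. Let $d_G(x,y)\in\{0,1,2,\dots,\infty\}$ be the length of a shortest path between $x$ and $y$, and let $N_G(v)=\{x\mid d_G(x,v)=1\}$. The graph $G$ is called *complete around* $v$ if $d_G(x,y)\le 1$ for all $x,y\in N_G(v)$; a vertex of $G$ around which $G$ is not complete is called *non-complete*. For a vertex $v$ of $G$ consider two operations: (1) $G_1$ is obtained by taking away $v$ and all edges of which $v$ is an end; (2) $G_2$ is obtained by adding all edges which connect two distinct vertices of $N_G(v)$. Put $P_G=(X_w,Y_w\mid w\in[n]\setminus V(G))+I_G$; so $P_G=I_G$ if $V(G)=[n]$. Then the following hold. (a) If $G$ is a simple graph on $[n]$ and $v$ is a vertex around which $G$ is not complete, then $$I_G=\bigl(I_G+(X_v,Y_v)\bigr)\cap\bigl(I_G+I_2(N_G(v))\bigr).$$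 (b) The two operations correspond to these ideals: for every simple graph $G$ with $V(G)\subseteq[n]$ and every vertex $v$ of $G$, $P_{G_1}=P_G+(X_v,Y_v)$ and $P_{G_2}=P_G+I_2(N_G(v))$. (c) If $V(G)\subseteq[n]$ and $v$ is a non-complete vertex of $G$, then each of $G_1$ and $G_2$ has strictly fewer non-complete vertices than $G$. (d) Let $G$ be a simple graph on $[n]$. Starting from $G$, repeat the following as long as possible: replace a graph having a non-complete vertex by the two graphs obtained from it by the operations (1) and (2) at one (arbitrarily chosen) non-complete vertex of it. This process can be carried out until no graph obtained has a non-complete vertex. Whatever the choices, the resulting set $\mathcal T$ of graphs satisfies: every $H\in\mathcal T$ is a disjoint union of complete graphs, $P_H$ is a prime ideal of $S$ for every $H\in\mathcal T$, $$I_G=\bigcap_{H\in\mathcal T}P_H,$$ and every minimal prime ideal of $I_G$ is one of the ideals $P_H$, $H\in\mathcal T$. -/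

import Mathlib

namespace EdgeMinor

open MvPolynomial

/-- The polynomial ring `K[X_i, Y_i | i ∈ [n]]`: the variable `(0, i)` is `X_i` and the variable
`(1, i)` is `Y_i`, so that the variables are the entries of a generic `2 × n` matrix. -/
abbrev PolyRing (n : ℕ) (K : Type*) [Field K] := MvPolynomial (Fin 2 × Fin n) K

section

variable {n : ℕ} (K : Type*) [Field K]

/-- The variable `X_i`. -/
noncomputable def xVar (i : Fin n) : PolyRing n K := X (0, i)

/-- The variable `Y_i`. -/
noncomputable def yVar (i : Fin n) : PolyRing n K := X (1, i)

/-- The `2`-minor `[i, j] = X_i Y_j - Y_i X_j`. -/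
noncomputable def minor (i j : Fin n) : PolyRing n K :=
  xVar K i * yVar K j - yVar K i * xVar K j

/-- The ideal `I_G`, generated by the minors `[i, j]` with `{i, j}` an edge of `G`. -/
noncomputable def edgeIdeal (G : SimpleGraph (Fin n)) : Ideal (PolyRing n K) :=
  Ideal.span {f | ∃ i j, G.Adj i j ∧ f = minor K i j}

/-- The ideal `I_2(A)`, generated by the minors `[a, b]` with `a, b ∈ A`. -/
noncomputable def minorIdeal (A : Set (Fin n)) : Ideal (PolyRing n K) :=
  Ideal.span {f | ∃ a ∈ A, ∃ b ∈ A, f = minor K a b}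

/-- The ideal `(X_v, Y_v)`. -/
noncomputable def vertexIdeal (v : Fin n) : Ideal (PolyRing n K) :=
  Ideal.span {xVar K v, yVar K v}

end

/-- `G` is complete around `v`: any two vertices of the neighbourhood of `v` are at distance at
most `1` (the distance is `⊤` for vertices that no path connects). -/
def CompleteAround {n : ℕ} (G : SimpleGraph (Fin n)) (v : Fin n) : Prop :=
  ∀ x ∈ G.neighborSet v, ∀ y ∈ G.neighborSet v, G.edist x y ≤ 1

/-- `G` is a disjoint union of complete graphs: every connected component is complete. -/
def IsDisjointUnionOfComplete {n : ℕ} (G : SimpleGraph (Fin n)) : Prop :=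
  ∀ c : G.ConnectedComponent, G.IsClique c.supp

/-- A simple graph whose vertex set `H.verts` is a subset of `[n]`, given as a subgraph of the
complete graph on `[n]`. Its edges, viewed as edges of a graph on `[n]`, are those of
`H.spanningCoe`; this does not change neighbourhoods and distances of vertices of `H`. -/
abbrev PartialGraph (n : ℕ) := (⊤ : SimpleGraph (Fin n)).Subgraph

/-- A graph on `[n]`, as a partial graph with vertex set all of `[n]`. -/
def ofGraph {n : ℕ} (G : SimpleGraph (Fin n)) : PartialGraph n :=
  SimpleGraph.toSubgraph G le_top

/-- The first operation: take away `v` and all edges of which `v` is an end. -/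
def removeVertex {n : ℕ} (H : PartialGraph n) (v : Fin n) : PartialGraph n :=
  H.deleteVerts {v}

/-- The second operation: add all edges which connect two vertices of the neighbourhood of `v`. -/
def completeNeighbors {n : ℕ} (H : PartialGraph n) (v : Fin n) : PartialGraph n where
  verts := H.verts
  Adj a b := H.Adj a b ∨ (a ≠ b ∧ a ∈ H.neighborSet v ∧ b ∈ H.neighborSet v)
  adj_sub := by
    rintro a b (h | h)
    · exact h.adj_sub
    · exact h.1
  edge_vert := by
    rintro a b (h | h)
    · exact H.edge_vert h
    · exact H.edge_vert h.2.1.symm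
  symm := ⟨fun _ _ h => h.elim (fun h => Or.inl h.symm)
    (fun h => Or.inr ⟨h.1.symm, h.2.2, h.2.1⟩)⟩

/-- The set of vertices of `H` around which `H` is not complete. -/
def nonComplete {n : ℕ} (H : PartialGraph n) : Set (Fin n) :=
  {u | u ∈ H.verts ∧ ¬ CompleteAround H.spanningCoe u}

/-- The ideal attached to a partial graph `H`: it is generated by the variables `X_w, Y_w` of the
vertices `w` that have been taken away and by the minors `[i, j]` of the edges of `H`. -/
noncomputable def partialIdeal {n : ℕ} (K : Type*) [Field K] (H : PartialGraph n) :
    Ideal (PolyRing n K) :=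
  (⨆ w ∈ H.vertsᶜ, vertexIdeal K w) ⊔ edgeIdeal K H.spanningCoe

/-- `Run H T`: the set `T` of graphs is a possible result of repeating the two operations from `H`.
A graph that is complete around all its vertices is left as it is; otherwise one chooses any vertex
around which the graph is not complete, and continues with both graphs that the two operations
produce, until all graphs are complete around all their vertices. -/
inductive Run {n : ℕ} : PartialGraph n → Set (PartialGraph n) → Prop
  | done (H : PartialGraph n) (h : nonComplete H = ∅) : Run H {H}
  | step (H : PartialGraph n) (v : Fin n) (hv : v ∈ nonComplete H) (A B : Set (PartialGraph n))
      (hA : Run (removeVertex H v) A) (hB : Run (completeNeighbors H v) B) : Run H (A ∪ B)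

end EdgeMinor

/-!
The decomposition at a vertex `v` rests on the substitution `φ` that sets `X_v` and `Y_v` to zero.
It maps `I_G` into itself, because it fixes or kills each generating minor, and it kills
`(X_v, Y_v)`; so `φ f ∈ I_G` for `f ∈ I_G + (X_v, Y_v)`. The Plücker relations give
`(X_v, Y_v) I_2(N(v)) ⊆ I_G`, whence `f - φ f ∈ I_G` for `f ∈ I_G + I_2(N(v))`. An element of both
ideals is therefore in `I_G`. Only the stability under `φ` matters, so the same argument serves for
the ideals of graphs on a part of `[n]` (`eq_sup_vertexIdeal_inf_sup_minorIdeal`).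

Neither operation creates a non-complete vertex, and both make `v` cease to be one, so the
process ends. It ends with graphs that are complete around every vertex, and in such a graph
a walk can be shortened to one edge; so they are disjoint unions of complete graphs. The edge ideal
of such a graph is prime since it is the kernel of the map `X_i ↦ s_c z_i`, `Y_i ↦ t_c z_i` into
a polynomial ring, where `c` is the connected component of `i` (`edgeIdeal_eq_ker`). As that map
sends monomials to monomials, this reduces to the congruence modulo the edge ideal of two monomials
with the same image, which swaps `X_j Y_i ≡ X_i Y_j` inside a component provide
(`monomial_sub_monomial_mem`). Missing vertices only contribute variables, and the ideal is then the
preimage of an edge ideal under a substitution that sets these to zero.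

A minimal prime of `I_G` contains the finite intersection of the primes `P_H`, hence one of them,
and equals it by minimality.
-/

namespace EdgeMinor

open MvPolynomial

/-! ### Setting variables to zero, and the decomposition at a vertex -/

section Kill

variable {n : ℕ} {K : Type*} [Field K]

open Classical in
/-- The substitution that sets the variables `X_w`, `Y_w` with `w ∈ W` to zero and fixes the other
variables. -/
noncomputable def killVertices (K : Type*) [Field K] (W : Set (Fin n)) :
    PolyRing n K →ₐ[K] PolyRing n K :=
  aeval fun p => if p.2 ∈ W then 0 else X p

lemma killVertices_xVar (W : Set (Fin n)) (i : Fin n) [Decidable (i ∈ W)] :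
    killVertices K W (xVar K i) = if i ∈ W then 0 else xVar K i := by
  simp only [killVertices, xVar, aeval_X]
  congr

lemma killVertices_yVar (W : Set (Fin n)) (i : Fin n) [Decidable (i ∈ W)] :
    killVertices K W (yVar K i) = if i ∈ W then 0 else yVar K i := by
  simp only [killVertices, yVar, aeval_X]
  congr

lemma killVertices_minor (W : Set (Fin n)) (i j : Fin n) :
    killVertices K W (minor K i j) = minor K i j ∨ killVertices K W (minor K i j) = 0 := by
  classical
  by_cases hi : i ∈ W
  · right; simp [minor, killVertices_xVar, killVertices_yVar, hi]
  by_cases hj : j ∈ W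
  · right; simp [minor, killVertices_xVar, killVertices_yVar, hj]
  · left; simp [minor, killVertices_xVar, killVertices_yVar, hi, hj]

lemma killVertices_minor_of_notMem {W : Set (Fin n)} {i j : Fin n} (hi : i ∉ W) (hj : j ∉ W) :
    killVertices K W (minor K i j) = minor K i j := by
  classical
  simp [minor, killVertices_xVar, killVertices_yVar, hi, hj]

lemma xVar_mem_vertexIdeal (v : Fin n) : xVar K v ∈ vertexIdeal K v :=
  Ideal.subset_span (by simp)

lemma yVar_mem_vertexIdeal (v : Fin n) : yVar K v ∈ vertexIdeal K v :=
  Ideal.subset_span (by simp)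

lemma vertexIdeal_le_iff {v : Fin n} {P : Ideal (PolyRing n K)} :
    vertexIdeal K v ≤ P ↔ xVar K v ∈ P ∧ yVar K v ∈ P := by
  simp [vertexIdeal, Ideal.span_le, Set.insert_subset_iff]

lemma minor_mem_edgeIdeal {G : SimpleGraph (Fin n)} {i j : Fin n} (h : G.Adj i j) :
    minor K i j ∈ edgeIdeal K G :=
  Ideal.subset_span ⟨i, j, h, rfl⟩

lemma edgeIdeal_le_iff {G : SimpleGraph (Fin n)} {P : Ideal (PolyRing n K)} :
    edgeIdeal K G ≤ P ↔ ∀ i j, G.Adj i j → minor K i j ∈ P := by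
  rw [edgeIdeal, Ideal.span_le]
  constructor
  · exact fun h i j hij => h ⟨i, j, hij, rfl⟩
  · rintro h _ ⟨i, j, hij, rfl⟩
    exact h i j hij

lemma minor_mem_minorIdeal {A : Set (Fin n)} {a b : Fin n} (ha : a ∈ A) (hb : b ∈ A) :
    minor K a b ∈ minorIdeal K A :=
  Ideal.subset_span ⟨a, ha, b, hb, rfl⟩

lemma minorIdeal_le_iff {A : Set (Fin n)} {P : Ideal (PolyRing n K)} :
    minorIdeal K A ≤ P ↔ ∀ a ∈ A, ∀ b ∈ A, minor K a b ∈ P := by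
  rw [minorIdeal, Ideal.span_le]
  constructor
  · exact fun h a ha b hb => h ⟨a, ha, b, hb, rfl⟩
  · rintro h _ ⟨a, ha, b, hb, rfl⟩
    exact h a ha b hb

@[simp] lemma minor_self (i : Fin n) : minor K i i = 0 := by
  simp only [minor]; ring

lemma edgeIdeal_le_comap_killVertices (W : Set (Fin n)) (G : SimpleGraph (Fin n)) :
    edgeIdeal K G ≤ (edgeIdeal K G).comap (killVertices K W) := by
  rw [edgeIdeal_le_iff]
  intro i j hij
  rw [Ideal.mem_comap]
  rcases killVertices_minor (K := K) W i j with h | h <;> rw [h]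
  · exact minor_mem_edgeIdeal hij
  · exact zero_mem _

lemma sub_killVertices_mem (W : Set (Fin n)) (f : PolyRing n K) :
    f - killVertices K W f ∈ ⨆ w ∈ W, vertexIdeal K w := by
  classical
  induction f using MvPolynomial.induction_on with
  | C a => simp [killVertices]
  | add p q hp hq =>
    rw [map_add, add_sub_add_comm]
    exact add_mem hp hq
  | mul_X p q hp =>
    -- the increment of a product: `pq - p'q' = (p - p')q + p'(q - q')`
    have hX : X q - killVertices K W (X q) ∈ ⨆ w ∈ W, vertexIdeal K w := by
      by_cases hq : q.2 ∈ W
      · have h : (X q : PolyRing n K) ∈ vertexIdeal K q.2 := by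
          obtain ⟨k, i⟩ := q
          fin_cases k
          · exact xVar_mem_vertexIdeal i
          · exact yVar_mem_vertexIdeal i
        simpa [killVertices, hq] using
          (le_iSup₂_of_le (f := fun w (_ : w ∈ W) => vertexIdeal K w) q.2 hq le_rfl) h
      · simp [killVertices, hq]
    have : p * X q - killVertices K W (p * X q)
        = (p - killVertices K W p) * X q
          + killVertices K W p * (X q - killVertices K W (X q)) := by
      rw [map_mul]; ring
    rw [this]
    exact add_mem (Ideal.mul_mem_right _ _ hp) (Ideal.mul_mem_left _ _ hX)

lemma vertexIdeal_le_ker_killVertices {W : Set (Fin n)} {w : Fin n} (hw : w ∈ W) :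
    vertexIdeal K w ≤ RingHom.ker (killVertices K W) := by
  classical
  rw [vertexIdeal_le_iff]
  simp [RingHom.mem_ker, killVertices_xVar, killVertices_yVar, hw]

lemma partialIdeal_le_comap_killVertices (W : Set (Fin n)) (H : PartialGraph n) :
    partialIdeal K H ≤ (partialIdeal K H).comap (killVertices K W) := by
  classical
  refine sup_le (iSup₂_le fun w hw => ?_) ?_
  · have hle : vertexIdeal K w ≤ partialIdeal K H :=
      (le_iSup₂_of_le (f := fun w (_ : w ∈ H.vertsᶜ) => vertexIdeal K w) w hw le_rfl).trans
        le_sup_left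
    rw [vertexIdeal_le_iff] at hle ⊢
    simp only [Ideal.mem_comap, killVertices_xVar, killVertices_yVar]
    split_ifs
    · simp
    · exact hle
  · exact (edgeIdeal_le_comap_killVertices W _).trans (Ideal.comap_mono le_sup_right)

/-- The Plücker relations `X_v [a, b] = X_a [v, b] - X_b [v, a]`, and likewise for `Y_v`, put
`(X_v, Y_v) I_2(N(v))` into the edge ideal. -/
lemma vertexIdeal_mul_minor_mem {G : SimpleGraph (Fin n)} {v a b : Fin n} (ha : G.Adj v a)
    (hb : G.Adj v b) {f : PolyRing n K} (hf : f ∈ vertexIdeal K v) :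
    f * minor K a b ∈ edgeIdeal K G := by
  have hle : vertexIdeal K v ≤ (edgeIdeal K G).colon {minor K a b} := by
    rw [vertexIdeal_le_iff]
    simp only [Submodule.mem_colon_singleton, smul_eq_mul]
    have hx : xVar K v * minor K a b = xVar K a * minor K v b - xVar K b * minor K v a := by
      simp only [minor]; ring
    have hy : yVar K v * minor K a b = yVar K a * minor K v b - yVar K b * minor K v a := by
      simp only [minor]; ring
    rw [hx, hy]
    exact ⟨sub_mem (Ideal.mul_mem_left _ _ (minor_mem_edgeIdeal hb))
        (Ideal.mul_mem_left _ _ (minor_mem_edgeIdeal ha)),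
      sub_mem (Ideal.mul_mem_left _ _ (minor_mem_edgeIdeal hb))
        (Ideal.mul_mem_left _ _ (minor_mem_edgeIdeal ha))⟩
  simpa [Submodule.mem_colon_singleton] using hle hf

/-- The decomposition at a vertex `v`, for every ideal `P` that contains the edge ideal and is
stable under setting `X_v` and `Y_v` to zero. Writing `φ` for this substitution, `f - φ f ∈ P` for
`f ∈ P + I_2(N(v))` by the Plücker relations, and `φ f ∈ P` for `f ∈ P + (X_v, Y_v)`. -/
lemma eq_sup_vertexIdeal_inf_sup_minorIdeal {G : SimpleGraph (Fin n)} {P : Ideal (PolyRing n K)}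
    (v : Fin n) (hG : edgeIdeal K G ≤ P) (hP : P ≤ P.comap (killVertices K {v})) :
    P = (P ⊔ vertexIdeal K v) ⊓ (P ⊔ minorIdeal K (G.neighborSet v)) := by
  refine le_antisymm (le_inf le_sup_left le_sup_left) ?_
  rintro f ⟨hf₁, hf₂⟩
  have h₁ : killVertices K {v} f ∈ P :=
    (sup_le hP ((vertexIdeal_le_ker_killVertices (Set.mem_singleton v)).trans
      fun g hg => by
        rw [RingHom.mem_ker] at hg
        rw [Ideal.mem_comap, hg]
        exact zero_mem _) : P ⊔ vertexIdeal K v ≤ P.comap (killVertices K {v})) hf₁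
  have h₂ : f - killVertices K {v} f ∈ P := by
    obtain ⟨p, hp, q, hq, rfl⟩ := Submodule.mem_sup.mp hf₂
    rw [map_add, add_sub_add_comm]
    refine add_mem (sub_mem hp (hP hp)) ?_
    clear hf₁ hf₂ h₁
    rw [minorIdeal] at hq
    induction hq using Submodule.span_induction with
    | zero => simp
    | add x y _ _ hx hy =>
      rw [map_add, add_sub_add_comm]
      exact add_mem hx hy
    | mem x hx =>
      obtain ⟨a, ha, b, hb, rfl⟩ := hx
      rw [killVertices_minor_of_notMem (by simpa using ha.ne') (by simpa using hb.ne'), sub_self]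
      exact zero_mem _
    | smul c x hx ih =>
      have hc : c - killVertices K {v} c ∈ vertexIdeal K v := by
        simpa using sub_killVertices_mem {v} c
      have hcx : (c - killVertices K {v} c) * x ∈ P := by
        have hle : minorIdeal K (G.neighborSet v) ≤
            (edgeIdeal K G).colon {c - killVertices K {v} c} := by
          rw [minorIdeal_le_iff]
          intro a ha b hb
          rw [Submodule.mem_colon_singleton, smul_eq_mul, mul_comm]
          exact vertexIdeal_mul_minor_mem ha hb hc
        have := hle hx
        rw [Submodule.mem_colon_singleton, smul_eq_mul, mul_comm] at this
        exact hG this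
      have : c • x - killVertices K {v} (c • x)
          = (c - killVertices K {v} c) * x
            + killVertices K {v} c * (x - killVertices K {v} x) := by
        rw [smul_eq_mul, map_mul]; ring
      rw [this]
      exact add_mem hcx (Ideal.mul_mem_left _ _ ih)
  simpa using add_mem h₂ h₁

end Kill

/-! ### Primality for disjoint unions of complete graphs -/

section Toric

variable {n : ℕ} {K : Type*} [Field K] {C : Type*}

/-- The effect on exponents of the substitution `X_i ↦ s_{c(i)} z_i`, `Y_i ↦ t_{c(i)} z_i`: the
variables `s_d`, `t_d` are `Sum.inl (0, d)`, `Sum.inl (1, d)`, and `z_i` is `Sum.inr i`. -/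
noncomputable def toricExponent (c : Fin n → C) :
    (Fin 2 × Fin n →₀ ℕ) →+ (Fin 2 × C ⊕ Fin n →₀ ℕ) :=
  Finsupp.liftAddHom fun p => (multiplesHom _
    (Finsupp.single (Sum.inl (p.1, c p.2)) 1 + Finsupp.single (Sum.inr p.2) 1))

lemma toricExponent_single (c : Fin n → C) (p : Fin 2 × Fin n) :
    toricExponent c (Finsupp.single p 1) =
      Finsupp.single (Sum.inl (p.1, c p.2)) 1 + Finsupp.single (Sum.inr p.2) 1 := by
  simp [toricExponent]

/-- The substitution `X_i ↦ s_{c(i)} z_i`, `Y_i ↦ t_{c(i)} z_i`. -/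
noncomputable def toricMap (K : Type*) [Field K] (c : Fin n → C) :
    PolyRing n K →ₐ[K] MvPolynomial (Fin 2 × C ⊕ Fin n) K :=
  aeval fun p => X (Sum.inl (p.1, c p.2)) * X (Sum.inr p.2)

lemma toricMap_monomial (c : Fin n → C) (m : Fin 2 × Fin n →₀ ℕ) :
    toricMap K c (monomial m 1) = monomial (toricExponent c m) 1 := by
  induction m using Finsupp.induction_linear with
  | zero => simp
  | add f g hf hg =>
    rw [map_add, ← one_mul (1 : K), ← monomial_mul, map_mul, hf, hg, monomial_mul]
  | single p k =>
    rw [← Finsupp.smul_single_one, map_nsmul, toricExponent_single, ← one_pow (M := K) k,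
      ← monomial_pow, ← monomial_pow, map_pow]
    congr 1
    change toricMap K c (X p) = _
    rw [toricMap, aeval_X, X, X, monomial_mul, one_mul]

lemma exists_of_toricExponent_inl_ne_zero {c : Fin n → C} {m : Fin 2 × Fin n →₀ ℕ} {k : Fin 2}
    {d : C} (h : toricExponent c m (Sum.inl (k, d)) ≠ 0) : ∃ j, c j = d ∧ m (k, j) ≠ 0 := by
  classical
  contrapose! h
  rw [toricExponent, Finsupp.liftAddHom_apply, Finsupp.sum, Finsupp.finsetSum_apply]
  refine Finset.sum_eq_zero fun p hp => ?_
  have : ¬ (p.1 = k ∧ c p.2 = d) := by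
    rintro ⟨rfl, hd⟩
    exact Finsupp.mem_support_iff.mp hp (h p.2 hd)
  simp [this]

lemma exists_of_toricExponent_inr_ne_zero {c : Fin n → C} {m : Fin 2 × Fin n →₀ ℕ} {i : Fin n}
    (h : toricExponent c m (Sum.inr i) ≠ 0) : ∃ k, m (k, i) ≠ 0 := by
  classical
  contrapose! h
  rw [toricExponent, Finsupp.liftAddHom_apply, Finsupp.sum, Finsupp.finsetSum_apply]
  refine Finset.sum_eq_zero fun p hp => ?_
  have : p.2 ≠ i := by
    rintro rfl
    exact Finsupp.mem_support_iff.mp hp (h p.1)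
  simp [this]

lemma exists_eq_add_single {σ : Type*} {m : σ →₀ ℕ} {p : σ} (h : m p ≠ 0) :
    ∃ r, m = r + Finsupp.single p 1 :=
  ⟨m - Finsupp.single p 1, (tsub_add_cancel_of_le (by
    rw [Finsupp.single_le_iff]; omega)).symm⟩

lemma monomial_add_single_one {σ : Type*} (m : σ →₀ ℕ) (p : σ) :
    (monomial (m + Finsupp.single p 1) 1 : MvPolynomial σ K) = monomial m 1 * X p := by
  rw [X, monomial_mul, one_mul]

/-- Two monomials with the same image under the substitution are congruent modulo the edge ideal.
If a variable of the first does not occur in the second, then a swap `X_j Y_i ≡ X_i Y_j` with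
`c i = c j` brings it in; so a common variable may be cancelled. -/
lemma monomial_sub_monomial_mem {G : SimpleGraph (Fin n)} {c : Fin n → C}
    (hc : ∀ i j, c i = c j → i = j ∨ G.Adj i j) (m m' : Fin 2 × Fin n →₀ ℕ)
    (h : toricExponent c m = toricExponent c m') :
    (monomial m 1 - monomial m' 1 : PolyRing n K) ∈ edgeIdeal K G := by
  have hminor : ∀ i j, c i = c j → minor K i j ∈ edgeIdeal K G := by
    intro i j hij
    rcases hc i j hij with rfl | hadj
    · simp
    · exact minor_mem_edgeIdeal hadj
  induction hN : m.degree generalizing m m' with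
  | zero =>
    obtain rfl : m = 0 := (Finsupp.degree_eq_zero_iff m).mp hN
    obtain rfl : m' = 0 := by
      by_contra hm'
      obtain ⟨⟨k, i⟩, hp⟩ := Finsupp.ne_iff.mp hm'
      obtain ⟨r, rfl⟩ := exists_eq_add_single hp
      have := DFunLike.congr_fun h (Sum.inr i)
      simp [toricExponent_single] at this
    simp
  | succ N ih =>
    have hm : m ≠ 0 := by rintro rfl; simp at hN
    obtain ⟨⟨k, i⟩, hp⟩ := Finsupp.ne_iff.mp hm
    obtain ⟨r, rfl⟩ := exists_eq_add_single hp
    have hr : r.degree = N := by simpa using hN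
    -- it suffices to replace `m'` by a congruent monomial in which `(k, i)` occurs
    have key : ∃ r', toricExponent c (r' + Finsupp.single (k, i) 1) = toricExponent c m' ∧
        (monomial (r' + Finsupp.single (k, i) 1) 1 - monomial m' 1 : PolyRing n K)
          ∈ edgeIdeal K G := by
      by_cases hki : m' (k, i) = 0
      · obtain ⟨l, hl⟩ : ∃ l, m' (l, i) ≠ 0 := exists_of_toricExponent_inr_ne_zero (c := c) (by
          rw [← h]; simp [toricExponent_single])
        obtain ⟨j, hj, hkj⟩ : ∃ j, c j = c i ∧ m' (k, j) ≠ 0 :=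
          exists_of_toricExponent_inl_ne_zero (by
            rw [← h]; simp [toricExponent_single])
        have hlk : l ≠ k := by rintro rfl; exact hl hki
        obtain ⟨q, rfl⟩ := exists_eq_add_single hl
        have hkj' : q (k, j) ≠ 0 := by
          simpa [Finsupp.single_apply, hlk] using hkj
        obtain ⟨q, rfl⟩ := exists_eq_add_single hkj'
        refine ⟨q + Finsupp.single (l, j) 1, ?_, ?_⟩
        · simp only [map_add, toricExponent_single, hj]
          abel
        · simp only [monomial_add_single_one]
          have : (monomial q 1 * X (l, j) * X (k, i) - monomial q 1 * X (k, j) * X (l, i) :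
              PolyRing n K) = monomial q 1 * minor K i j
              ∨ (monomial q 1 * X (l, j) * X (k, i) - monomial q 1 * X (k, j) * X (l, i) :
              PolyRing n K) = monomial q 1 * minor K j i := by
            simp only [minor, xVar, yVar]
            fin_cases l <;> fin_cases k
            · exact absurd rfl hlk
            · right; simp only [Fin.mk_zero, Fin.mk_one]; ring
            · left; simp only [Fin.mk_zero, Fin.mk_one]; ring
            · exact absurd rfl hlk
          rcases this with h' | h' <;> rw [h']
          · exact Ideal.mul_mem_left _ _ (hminor _ _ hj.symm)
          · exact Ideal.mul_mem_left _ _ (hminor _ _ hj)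
      · obtain ⟨r', rfl⟩ := exists_eq_add_single hki
        exact ⟨r', rfl, by simp⟩
    obtain ⟨r', hr', hmem⟩ := key
    have hrr' : toricExponent c r = toricExponent c r' := by
      rw [← hr', map_add, map_add] at h
      exact add_right_cancel h
    have := add_mem (Ideal.mul_mem_right (X (k, i)) _ (ih r r' hrr' hr)) hmem
    rw [sub_mul, ← monomial_add_single_one, ← monomial_add_single_one] at this
    simpa using this

/-- The edge ideal of a disjoint union of complete graphs is the kernel of the substitution: the
class of a monomial modulo the edge ideal depends only on its image. -/
lemma edgeIdeal_eq_ker {G : SimpleGraph (Fin n)} {c : Fin n → C}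
    (hc : ∀ i j, c i = c j → i = j ∨ G.Adj i j) (hadj : ∀ i j, G.Adj i j → c i = c j) :
    edgeIdeal K G = RingHom.ker (toricMap K c) := by
  apply le_antisymm
  · rw [edgeIdeal_le_iff]
    intro i j hij
    simp only [RingHom.mem_ker, minor, xVar, yVar, map_sub, map_mul, toricMap, aeval_X,
      hadj i j hij]
    ring
  · intro f hf
    let L : MvPolynomial (Fin 2 × C ⊕ Fin n) K →ₗ[K] PolyRing n K ⧸ edgeIdeal K G :=
      (basisMonomials _ K).constr K fun μ =>
        Ideal.Quotient.mk _ (monomial (Function.invFun (toricExponent c) μ) 1)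
    have hL : L ∘ₗ (toricMap K c).toLinearMap
        = (Ideal.Quotient.mkₐ K (edgeIdeal K G)).toLinearMap := by
      refine (basisMonomials _ K).ext fun m => ?_
      have hb : L (monomial (toricExponent c m) 1) = Ideal.Quotient.mk _
          (monomial (Function.invFun (toricExponent c) (toricExponent c m)) 1) := by
        simpa only [coe_basisMonomials] using (basisMonomials _ K).constr_basis K
          (fun μ => (Ideal.Quotient.mk (edgeIdeal K G)
            (monomial (Function.invFun (toricExponent c) μ) 1))) (toricExponent c m)
      simp only [coe_basisMonomials, LinearMap.comp_apply, AlgHom.toLinearMap_apply,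
        toricMap_monomial, hb, Ideal.Quotient.mkₐ_eq_mk]
      exact Ideal.Quotient.eq.mpr (monomial_sub_monomial_mem hc _ _
        (Function.invFun_eq ⟨m, rfl⟩))
    have := LinearMap.congr_fun hL f
    rw [RingHom.mem_ker] at hf
    simpa [hf, Ideal.Quotient.eq_zero_iff_mem] using this.symm

lemma edgeIdeal_isPrime {G : SimpleGraph (Fin n)} (hG : IsDisjointUnionOfComplete G) :
    (edgeIdeal K G).IsPrime := by
  rw [edgeIdeal_eq_ker (c := G.connectedComponentMk)]
  · exact RingHom.ker_isPrime _
  · intro i j hij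
    by_contra! hne
    exact hne.2 (hG (G.connectedComponentMk j) hij rfl hne.1)
  · exact fun i j hij => SimpleGraph.ConnectedComponent.sound hij.reachable

/-- Setting the variables of the missing vertices to zero reduces the ideal of a partial graph to
an edge ideal. -/
lemma partialIdeal_eq_comap (H : PartialGraph n) :
    partialIdeal K H = (edgeIdeal K H.spanningCoe).comap (killVertices K H.vertsᶜ) := by
  apply le_antisymm
  · refine sup_le (iSup₂_le fun w hw => (vertexIdeal_le_ker_killVertices hw).trans fun g hg => ?_)
      (edgeIdeal_le_comap_killVertices _ _)
    rw [RingHom.mem_ker] at hg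
    rw [Ideal.mem_comap, hg]
    exact zero_mem _
  · intro f hf
    have := add_mem (Ideal.mem_sup_left (sub_killVertices_mem H.vertsᶜ f) :
      f - killVertices K H.vertsᶜ f ∈ partialIdeal K H) (Ideal.mem_sup_right hf)
    rwa [sub_add_cancel] at this

lemma partialIdeal_isPrime {H : PartialGraph n}
    (hH : IsDisjointUnionOfComplete H.spanningCoe) : (partialIdeal K H).IsPrime := by
  have := edgeIdeal_isPrime (K := K) hH
  rw [partialIdeal_eq_comap]
  exact Ideal.comap_isPrime _ _

end Toric

/-! ### The two operations on graphs -/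

section Operations

variable {n : ℕ}

lemma edist_le_one_iff {G : SimpleGraph (Fin n)} {x y : Fin n} :
    G.edist x y ≤ 1 ↔ x = y ∨ G.Adj x y := by
  rw [le_iff_lt_or_eq, SimpleGraph.edist_eq_one_iff_adj, Order.lt_one_iff,
    SimpleGraph.edist_eq_zero_iff]

lemma completeAround_spanningCoe_iff {H : PartialGraph n} {v : Fin n} :
    CompleteAround H.spanningCoe v ↔
      ∀ x, H.Adj v x → ∀ y, H.Adj v y → x = y ∨ H.Adj x y := by
  simp [CompleteAround, edist_le_one_iff]

lemma removeVertex_adj {H : PartialGraph n} {v a b : Fin n} :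
    (removeVertex H v).Adj a b ↔ a ≠ v ∧ b ≠ v ∧ H.Adj a b := by
  simp only [removeVertex, SimpleGraph.Subgraph.deleteVerts_adj, Set.mem_singleton_iff]
  exact ⟨fun h => ⟨h.2.1, h.2.2.2.1, h.2.2.2.2⟩,
    fun h => ⟨h.2.2.fst_mem, h.1, h.2.2.snd_mem, h.2.1, h.2.2⟩⟩

lemma completeNeighbors_adj {H : PartialGraph n} {v a b : Fin n} :
    (completeNeighbors H v).Adj a b ↔ H.Adj a b ∨ (a ≠ b ∧ H.Adj v a ∧ H.Adj v b) :=
  Iff.rfl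

lemma ncard_nonComplete_removeVertex_lt {H : PartialGraph n} {v : Fin n}
    (hv : v ∈ nonComplete H) :
    (nonComplete (removeVertex H v)).ncard < (nonComplete H).ncard := by
  refine Set.ncard_lt_ncard ⟨fun u hu => ⟨hu.1.1, fun hc => hu.2 ?_⟩, fun h => (h hv).1.2 rfl⟩
  rw [completeAround_spanningCoe_iff] at hc ⊢
  simp only [removeVertex_adj]
  exact fun x hx y hy => (hc x hx.2.2 y hy.2.2).imp_right fun h => ⟨hx.2.1, hy.2.1, h⟩

/-- A vertex `u` that was complete stays so: if `u` is a neighbour of `v`, then `u` and all its old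
and new neighbours lie in the neighbourhood of `v` together with `v`. -/
lemma ncard_nonComplete_completeNeighbors_lt {H : PartialGraph n} {v : Fin n}
    (hv : v ∈ nonComplete H) :
    (nonComplete (completeNeighbors H v)).ncard < (nonComplete H).ncard := by
  refine Set.ncard_lt_ncard ⟨fun u hu => ⟨hu.1, fun hc => hu.2 ?_⟩, fun h => (h hv).2 ?_⟩
  · rw [completeAround_spanningCoe_iff] at hc ⊢
    simp only [completeNeighbors_adj]
    have hs : ∀ a b, H.Adj a b → H.Adj b a := fun a b h => h.symm
    grind
  · rw [completeAround_spanningCoe_iff]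
    simp only [completeNeighbors_adj]
    have hs : ∀ a, ¬ H.Adj a a := fun a h => h.ne rfl
    grind

lemma isDisjointUnionOfComplete_of_nonComplete_eq_empty {H : PartialGraph n}
    (h : nonComplete H = ∅) : IsDisjointUnionOfComplete H.spanningCoe := by
  have hc : ∀ u x, H.Adj u x → ∀ y, H.Adj u y → x = y ∨ H.Adj x y := by
    intro u x hx
    rw [Set.eq_empty_iff_forall_notMem] at h
    exact completeAround_spanningCoe_iff.mp
      (by_contra fun hcon => h u ⟨hx.fst_mem, hcon⟩) x hx
  have hw : ∀ x y, H.spanningCoe.Walk x y → x = y ∨ H.Adj x y := by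
    intro x y p
    induction p with
    | nil => exact Or.inl rfl
    | cons hadj _ ih =>
      rcases ih with rfl | ih
      · exact Or.inr hadj
      · exact hc _ _ (SimpleGraph.Subgraph.Adj.symm hadj) _ ih
  rintro d x hx y hy hne
  obtain ⟨p⟩ := SimpleGraph.ConnectedComponent.exact (hx.trans hy.symm)
  exact (hw x y p).resolve_left hne

lemma exists_run (H : PartialGraph n) : ∃ T, Run H T := by
  induction hN : (nonComplete H).ncard using Nat.strong_induction_on generalizing H with
  | _ N ih =>
    rcases (nonComplete H).eq_empty_or_nonempty with h | ⟨v, hv⟩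
    · exact ⟨_, Run.done H h⟩
    · obtain ⟨A, hA⟩ := ih _ (hN ▸ ncard_nonComplete_removeVertex_lt hv) _ rfl
      obtain ⟨B, hB⟩ := ih _ (hN ▸ ncard_nonComplete_completeNeighbors_lt hv) _ rfl
      exact ⟨_, Run.step H v hv A B hA hB⟩

lemma Run.isDisjointUnionOfComplete {H : PartialGraph n} {T : Set (PartialGraph n)}
    (hT : Run H T) : ∀ F ∈ T, IsDisjointUnionOfComplete F.spanningCoe := by
  induction hT with
  | done H h =>
    rintro _ rfl
    exact isDisjointUnionOfComplete_of_nonComplete_eq_empty h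
  | step H v hv A B _ _ ihA ihB =>
    rintro F (hF | hF)
    exacts [ihA F hF, ihB F hF]

end Operations

/-! ### The ideals of the graphs produced by the operations -/

section Ideals

variable {n : ℕ} {K : Type*} [Field K]

lemma partialIdeal_le_iff {H : PartialGraph n} {P : Ideal (PolyRing n K)} :
    partialIdeal K H ≤ P ↔
      (∀ w ∉ H.verts, vertexIdeal K w ≤ P) ∧ ∀ i j, H.Adj i j → minor K i j ∈ P := by
  simp [partialIdeal, edgeIdeal_le_iff]

lemma vertexIdeal_le_partialIdeal {H : PartialGraph n} {w : Fin n} (hw : w ∉ H.verts) :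
    vertexIdeal K w ≤ partialIdeal K H :=
  (partialIdeal_le_iff.mp le_rfl).1 w hw

lemma minor_mem_partialIdeal {H : PartialGraph n} {i j : Fin n} (h : H.Adj i j) :
    minor K i j ∈ partialIdeal K H :=
  (partialIdeal_le_iff.mp le_rfl).2 i j h

lemma partialIdeal_removeVertex (H : PartialGraph n) (v : Fin n) :
    partialIdeal K (removeVertex H v) = partialIdeal K H ⊔ vertexIdeal K v := by
  have hv : vertexIdeal K v ≤ partialIdeal K (removeVertex H v) :=
    vertexIdeal_le_partialIdeal fun h => h.2 rfl
  apply le_antisymm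
  · refine partialIdeal_le_iff.mpr ⟨fun w hw => ?_, fun i j hij => ?_⟩
    · by_cases hwv : w = v
      · exact hwv ▸ le_sup_right
      · exact (vertexIdeal_le_partialIdeal fun h => hw ⟨h, hwv⟩).trans le_sup_left
    · exact Ideal.mem_sup_left (minor_mem_partialIdeal (removeVertex_adj.mp hij).2.2)
  · refine sup_le (partialIdeal_le_iff.mpr ⟨fun w hw => ?_, fun i j hij => ?_⟩) hv
    · exact vertexIdeal_le_partialIdeal fun h => hw h.1
    -- a minor of an edge at `v` lies in `(X_v, Y_v)`
    · rw [vertexIdeal_le_iff] at hv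
      by_cases hi : i = v
      · subst hi
        exact sub_mem (Ideal.mul_mem_right _ _ hv.1) (Ideal.mul_mem_right _ _ hv.2)
      by_cases hj : j = v
      · subst hj
        exact sub_mem (Ideal.mul_mem_left _ _ hv.2) (Ideal.mul_mem_left _ _ hv.1)
      · exact minor_mem_partialIdeal (removeVertex_adj.mpr ⟨hi, hj, hij⟩)

lemma partialIdeal_completeNeighbors (H : PartialGraph n) (v : Fin n) :
    partialIdeal K (completeNeighbors H v) =
      partialIdeal K H ⊔ minorIdeal K (H.neighborSet v) := by
  apply le_antisymm
  · refine partialIdeal_le_iff.mpr ⟨fun w hw => ?_, fun i j hij => ?_⟩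
    · exact (vertexIdeal_le_partialIdeal (H := H) hw).trans le_sup_left
    · rcases hij with h | ⟨-, hi, hj⟩
      · exact Ideal.mem_sup_left (minor_mem_partialIdeal h)
      · exact Ideal.mem_sup_right (minor_mem_minorIdeal hi hj)
  · refine sup_le (partialIdeal_le_iff.mpr ⟨fun w hw => ?_, fun i j hij => ?_⟩)
      (minorIdeal_le_iff.mpr fun a ha b hb => ?_)
    · exact vertexIdeal_le_partialIdeal (H := completeNeighbors H v) hw
    · exact minor_mem_partialIdeal (Or.inl hij)
    · by_cases hab : a = b
      · subst hab
        simp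
      · exact minor_mem_partialIdeal (Or.inr ⟨hab, ha, hb⟩)

lemma partialIdeal_eq_inf (H : PartialGraph n) (v : Fin n) :
    partialIdeal K H =
      partialIdeal K (removeVertex H v) ⊓ partialIdeal K (completeNeighbors H v) := by
  rw [partialIdeal_removeVertex, partialIdeal_completeNeighbors]
  exact eq_sup_vertexIdeal_inf_sup_minorIdeal (G := H.spanningCoe) v le_sup_right
    (partialIdeal_le_comap_killVertices _ H)

lemma Run.partialIdeal_eq_iInf {H : PartialGraph n} {T : Set (PartialGraph n)} (hT : Run H T) :
    partialIdeal K H = ⨅ F ∈ T, partialIdeal K F := by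
  induction hT with
  | done H h => simp
  | step H v hv A B _ _ ihA ihB => rw [iInf_union, ← ihA, ← ihB, ← partialIdeal_eq_inf]

lemma partialIdeal_ofGraph (G : SimpleGraph (Fin n)) :
    partialIdeal K (ofGraph G) = edgeIdeal K G := by
  have h : (ofGraph G).spanningCoe = G := rfl
  have hv : (ofGraph G).vertsᶜ = ∅ := Set.compl_univ
  rw [partialIdeal, h, hv]
  simp

end Ideals

end EdgeMinor

/-! ### The decomposition of the edge ideal -/

open EdgeMinor

theorem lemma4p3 (n : ℕ) (K : Type*) [Field K] :
    -- the decomposition at one vertex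
    (∀ (G : SimpleGraph (Fin n)) (v : Fin n), ¬ EdgeMinor.CompleteAround G v →
      EdgeMinor.edgeIdeal K G =
        (EdgeMinor.edgeIdeal K G ⊔ EdgeMinor.vertexIdeal K v) ⊓
          (EdgeMinor.edgeIdeal K G ⊔ EdgeMinor.minorIdeal K (G.neighborSet v))) ∧
    -- the two ideals are those attached to the graphs which the two operations produce
    (∀ (H : EdgeMinor.PartialGraph n) (v : Fin n),
      EdgeMinor.partialIdeal K (EdgeMinor.removeVertex H v) =
          EdgeMinor.partialIdeal K H ⊔ EdgeMinor.vertexIdeal K v ∧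
        EdgeMinor.partialIdeal K (EdgeMinor.completeNeighbors H v) =
          EdgeMinor.partialIdeal K H ⊔ EdgeMinor.minorIdeal K (H.neighborSet v)) ∧
    -- each operation strictly decreases the number of non-complete vertices
    (∀ (H : EdgeMinor.PartialGraph n), ∀ v ∈ EdgeMinor.nonComplete H,
      (EdgeMinor.nonComplete (EdgeMinor.removeVertex H v)).ncard <
          (EdgeMinor.nonComplete H).ncard ∧
        (EdgeMinor.nonComplete (EdgeMinor.completeNeighbors H v)).ncard <
          (EdgeMinor.nonComplete H).ncard) ∧
    -- repeating the operations ends, and every way of doing so decomposes the ideal into primes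
    (∀ G : SimpleGraph (Fin n),
      (∃ T, EdgeMinor.Run (EdgeMinor.ofGraph G) T) ∧
      ∀ T, EdgeMinor.Run (EdgeMinor.ofGraph G) T →
        (∀ H ∈ T, EdgeMinor.IsDisjointUnionOfComplete H.spanningCoe ∧
          (EdgeMinor.partialIdeal K H).IsPrime) ∧
        EdgeMinor.edgeIdeal K G = ⨅ H ∈ T, EdgeMinor.partialIdeal K H ∧
        (EdgeMinor.edgeIdeal K G).minimalPrimes ⊆ EdgeMinor.partialIdeal K '' T) := by
  refine ⟨fun G v _ => ?_, fun H v => ⟨?_, ?_⟩, fun H v hv => ⟨?_, ?_⟩, fun G =>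
    ⟨?_, fun T hT => ?_⟩⟩
  · exact eq_sup_vertexIdeal_inf_sup_minorIdeal v le_rfl (edgeIdeal_le_comap_killVertices _ G)
  · exact partialIdeal_removeVertex H v
  · exact partialIdeal_completeNeighbors H v
  · exact ncard_nonComplete_removeVertex_lt hv
  · exact ncard_nonComplete_completeNeighbors_lt hv
  · exact exists_run _
  · have hprime : ∀ H ∈ T, (partialIdeal K H).IsPrime := fun H hH =>
      partialIdeal_isPrime (hT.isDisjointUnionOfComplete H hH)
    have hI : edgeIdeal K G = ⨅ H ∈ T, partialIdeal K H := by
      rw [← partialIdeal_ofGraph, hT.partialIdeal_eq_iInf]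
    refine ⟨fun H hH => ⟨hT.isDisjointUnionOfComplete H hH, hprime H hH⟩, hI, fun p hp => ?_⟩
    -- a prime that contains a finite intersection of ideals contains one of them
    have hfin : T.Finite := Set.toFinite T
    have hle : hfin.toFinset.inf (partialIdeal K) ≤ p := by
      have := hp.1.2
      rw [hI] at this
      simpa [Finset.inf_eq_iInf] using this
    obtain ⟨H, hH, hHp⟩ := (Ideal.IsPrime.inf_le' hp.1.1).mp hle
    rw [Set.Finite.mem_toFinset] at hH
    have hIH : edgeIdeal K G ≤ partialIdeal K H := hI.le.trans (iInf₂_le H hH)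
    exact ⟨H, hH, le_antisymm hHp (hp.2 ⟨hprime H hH, hIH⟩ hHp)⟩
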